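/- Let $(\omega_n)_{n\ge1}$ be independent random variables uniformly distributed on the circle $\mathbb T=\mathbb R/\mathbb Z$, let $c>0$ and $\ell_n=c\,\frac{\ln n}{n}$. Put $$E_n=\bigcup_{k=1}^n\Bigl(\omega_k-\tfrac{\ell_n}{2},\ \omega_k+\tfrac{\ell_n}{2}\Bigr)\subset\mathbb T,\qquad \mathcal U(\omega)=\liminf_{n\to\infty}E_n=\bigcup_{N}\bigcap_{n\ge N}E_n .$$ Let $A\subset\mathbb T$; let $\dim_{\mathrm H}A$ be its Hausdorff dimension and $\overline{\dim}_{\mathrm B}A=\limsup_{\varepsilon\to0+}\frac{\ln N(\varepsilon,A)}{\ln(1/\varepsilon)}$ its upper box dimension, where $N(\varepsilon,A)$ is the least number of balls of radius $\varepsilon$ that cover $A$. 1. If $c>\overline{\dim}_{\mathrm B}A+1$, then almost surely $A\subset\mathcal U(\omega)$. 2. If $c<\dim_{\mathrm H}A$, then $A$ is not covered, in the following sense. If $A$ is an analytic set (for instance a Borel set), then $\Pr(A\subset\mathcal U(\omega))=0$. For an arbitrary set $A$, the set of sequences $\{x\in\mathbb T^{\mathbb N}: A\subset\mathcal U(x)\}$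 has inner measure zero for the law of $(\omega_n)$: every measurable $S\subset\mathbb T^{\mathbb N}$ that is contained in it satisfies $\Pr((\omega_n)_n\in S)=0$. In particular, this set of sequences has measure $0$ whenever it is measurable with respect to the completed law. -/

import Mathlib

open MeasureTheory ProbabilityTheory Filter Topology
open scoped NNReal ENNReal

/-- The upper box-counting (upper Minkowski) dimension
`limsup_{ε → 0+} log N(ε, A) / log (1/ε)`, where `N(ε, A)` is the least number of balls of radius
`ε` (with arbitrary centers) that cover `A`. It takes values in the extended reals (and equals
`-∞` at the empty set, where `log 0 = -∞`). -/
noncomputable def upperBoxDim {T : Type*} [PseudoEMetricSpace T] (A : Set T) : EReal :=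
  limsup (fun ε : ℝ≥0 =>
    ENNReal.log ((Metric.externalCoveringNumber ε A : ℕ∞) : ℝ≥0∞) /
      ((Real.log (1 / (ε : ℝ)) : ℝ) : EReal)) (𝓝[>] 0)

/-- The set `E_n`: the union of the first `n` arcs, all of the same length `ℓ n`, centered at the
first `n` points of the sequence. The sequence of centers is indexed from `0`, so `x k` is the
center number `k + 1`. -/
def coverStage (ℓ : ℕ → ℝ) (x : ℕ → UnitAddCircle) (n : ℕ) : Set UnitAddCircle :=
  ⋃ k ∈ Finset.range n, Metric.ball (x k) (ℓ n / 2)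

/-- The uniformly covered set `𝒰 = liminf E_n`. -/
def uniformCover (ℓ : ℕ → ℝ) (x : ℕ → UnitAddCircle) : Set UnitAddCircle :=
  liminf (coverStage ℓ x) atTop

/-- The lengths `ℓ_n = c ln n / n`. -/
noncomputable def logLength (c : ℝ) (n : ℕ) : ℝ := c * Real.log n / n

/-! Covering half: for `d` slightly above the upper box dimension, at most about `n ^ d` balls of
radius `δ * ℓ n` cover `A`. If the shrunken arcs catch every center of these balls, the full arcs
catch all of `A`. A given center is missed with probability about `n ^ (-c (1 - 2δ))`, so for `c > d
+ 1` and small `δ` the union bound is summable and Borel–Cantelli applies.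

Non-covering half: the second moment method only handles a set fixed in advance. If `B` is covered
at all stages `n ≥ N` on one event of probability `q > 0`, every `ℓ n`-separated finite `D ⊆ B`
satisfies `q * #D * (1 - ℓ n) ^ n ≤ 1`. Hence the packing numbers of `B` are `O(n ^ c')` for each
`c' > c`, and `dimH B ≤ c` (`dimH_le_of_forall_mem_closedBall`). For `A` itself the stage `N`
depends on the point and on the sequence. Baire's theorem removes this dependence. Given a compact
set `K` of covering sequences with positive measure, each `t ∈ A` yields closed sets `C t N` that
exhaust `K`, so some `C t N` contains a member `V` of a fixed countable family of sets of positive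
measure (`IsCompact.exists_countable_family_subset_of_closed_cover`). Thus `A` is contained in
countably many sets `B V N`, each covered uniformly on an event of positive probability, and
countable stability gives `dimH A ≤ c`.

This shows inner measure zero. For analytic `A` the non-covering set is analytic, and capacitability
turns inner measure zero of its complement into outer measure zero. -/

/-! ### Second moment method -/

/-- Second moment bound: if the events `G t`, `t ∈ D`, all have probability `p` and are pairwise
non-positively correlated, the probability that none of them occurs is at most `1 / (#D * p)`. -/
lemma measureReal_iInter_compl_mul_le_one {Ω ι : Type*} [MeasurableSpace Ω] (P : Measure Ω)
    [IsProbabilityMeasure P] (D : Finset ι) (G : ι → Set Ω) (hG : ∀ t ∈ D, MeasurableSet (G t))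
    (p : ℝ) (hp : ∀ t ∈ D, P.real (G t) = p)
    (hpair : ∀ t ∈ D, ∀ u ∈ D, t ≠ u → P.real (G t ∩ G u) ≤ p ^ 2) :
    P.real (⋂ t ∈ D, (G t)ᶜ) * (D.card * p) ≤ 1 := by
  classical
  set m : ℝ := D.card * p with hm
  rcases D.eq_empty_or_nonempty with rfl | ⟨t₀, ht₀⟩
  · simp [hm]
  have hp0 : 0 ≤ p := hp t₀ ht₀ ▸ measureReal_nonneg
  have hm0 : 0 ≤ m := by positivity
  set Z : Ω → ℝ := fun a => ∑ t ∈ D, (G t).indicator 1 a with hZ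
  have hint : ∀ t ∈ D, Integrable ((G t).indicator (1 : Ω → ℝ)) P := fun t ht =>
    (integrable_const (1 : ℝ)).indicator (hG t ht)
  have hint2 : ∀ t ∈ D, ∀ u ∈ D, Integrable ((G t ∩ G u).indicator (1 : Ω → ℝ)) P :=
    fun t ht u hu => (integrable_const (1 : ℝ)).indicator ((hG t ht).inter (hG u hu))
  have hZi : Integrable Z P := integrable_finsetSum _ hint
  have hZ1 : ∫ a, Z a ∂P = m := by
    rw [hZ, integral_finsetSum _ hint]
    rw [Finset.sum_congr rfl fun t ht => by rw [integral_indicator_one (hG t ht), hp t ht]]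
    simp [hm]
  have hsq : ∀ a, Z a ^ 2 = ∑ t ∈ D, ∑ u ∈ D, (G t ∩ G u).indicator (1 : Ω → ℝ) a := by
    intro a
    rw [sq, hZ, Finset.sum_mul_sum]
    refine Finset.sum_congr rfl fun t _ => Finset.sum_congr rfl fun u _ => ?_
    rw [Set.inter_indicator_one]
    rfl
  have hZ2i : Integrable (fun a => Z a ^ 2) P := by
    simp_rw [hsq]
    exact integrable_finsetSum _ fun t ht => integrable_finsetSum _ fun u hu => hint2 t ht u hu
  have hZ2 : ∫ a, Z a ^ 2 ∂P ≤ m + m ^ 2 := by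
    simp_rw [hsq]
    rw [integral_finsetSum _ fun t ht => integrable_finsetSum _ fun u hu => hint2 t ht u hu]
    have hrow : ∀ t ∈ D, ∫ a, ∑ u ∈ D, (G t ∩ G u).indicator (1 : Ω → ℝ) a ∂P
        ≤ p + D.card * p ^ 2 := by
      intro t ht
      rw [integral_finsetSum _ fun u hu => hint2 t ht u hu]
      rw [Finset.sum_congr rfl fun u hu =>
        integral_indicator_one ((hG t ht).inter (hG u hu)), ← Finset.add_sum_erase D _ ht,
        Set.inter_self, hp t ht]
      gcongr
      calc ∑ u ∈ D.erase t, P.real (G t ∩ G u) ≤ ∑ u ∈ D.erase t, p ^ 2 :=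
            Finset.sum_le_sum fun u hu => hpair t ht u (Finset.mem_of_mem_erase hu)
              (Finset.ne_of_mem_erase hu).symm
        _ = (D.erase t).card * p ^ 2 := by simp
        _ ≤ D.card * p ^ 2 := by
            gcongr
            exact Finset.erase_subset _ _
    calc _ ≤ ∑ t ∈ D, (p + D.card * p ^ 2) := Finset.sum_le_sum hrow
      _ = m + m ^ 2 := by simp [hm]; ring
  set N : Set Ω := ⋂ t ∈ D, (G t)ᶜ with hN
  have hNm : MeasurableSet N := Finset.measurableSet_biInter _ fun t ht => (hG t ht).compl
  -- Chebyshev's inequality: `Z` counts the events that occur, so `(Z - m) ^ 2 = m ^ 2` on `N`. The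
  -- variance is at most `m` by `hZ2`.
  have hle : P.real N * m ^ 2 ≤ ∫ a, (Z a - m) ^ 2 ∂P := by
    have hexp : Integrable (fun a => (Z a - m) ^ 2) P := by
      have : (fun a => (Z a - m) ^ 2) = fun a => Z a ^ 2 - 2 * m * Z a + m ^ 2 := by
        ext a; ring
      rw [this]
      exact (hZ2i.sub (hZi.const_mul _)).add (integrable_const _)
    rw [← smul_eq_mul, ← integral_indicator_const _ hNm]
    refine integral_mono ((integrable_const _).indicator hNm) hexp fun a => ?_
    by_cases ha : a ∈ N
    · have : Z a = 0 := Finset.sum_eq_zero fun t ht => by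
        have := Set.mem_iInter₂.1 ha t ht
        simpa using this
      simp [ha, this]
    · simp only [ha, not_false_eq_true, Set.indicator_of_notMem]
      positivity
  have heq : ∫ a, (Z a - m) ^ 2 ∂P = ∫ a, Z a ^ 2 ∂P - m ^ 2 := by
    have : (fun a => (Z a - m) ^ 2) = fun a => Z a ^ 2 - 2 * m * Z a + m ^ 2 := by
      ext a; ring
    have hsub : Integrable (fun a => Z a ^ 2 - 2 * m * Z a) P := hZ2i.sub (hZi.const_mul _)
    rw [this, integral_add hsub (integrable_const _),
      integral_sub hZ2i (hZi.const_mul _), integral_const_mul, hZ1]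
    simp
    ring
  rcases hm0.eq_or_lt with h | h
  · simp [← h]
  · have : P.real N * m * m ≤ 1 * m := by nlinarith
    exact le_of_mul_le_mul_right this h

instance UnitAddCircle.isProbabilityMeasure_volume :
    IsProbabilityMeasure (volume : Measure UnitAddCircle) :=
  ⟨UnitAddCircle.measure_univ⟩

/-! ### Independent uniform points on the circle -/

section UniformPoints

variable {Ω : Type*} [MeasurableSpace Ω] {P : Measure Ω} {X : ℕ → Ω → UnitAddCircle}

lemma measurableSet_forall_range_notMem (hmeas : ∀ n, Measurable (X n)) (n : ℕ)
    {B : Set UnitAddCircle} (hB : MeasurableSet B) :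
    MeasurableSet {a | ∀ k ∈ Finset.range n, X k a ∉ B} := by
  have : {a | ∀ k ∈ Finset.range n, X k a ∉ B} = ⋂ k ∈ Finset.range n, X k ⁻¹' Bᶜ := by
    ext; simp
  rw [this]
  exact Finset.measurableSet_biInter _ fun k _ => hmeas k hB.compl

/-- The probability that the first `n` of the independent uniform points avoid `B`. -/
lemma measureReal_forall_range_notMem (hmeas : ∀ n, Measurable (X n)) (hindep : iIndepFun X P)
    (hunif : ∀ n, P.map (X n) = volume) (n : ℕ) {B : Set UnitAddCircle} (hB : MeasurableSet B) :
    P.real {a | ∀ k ∈ Finset.range n, X k a ∉ B} =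
      (1 - (volume : Measure UnitAddCircle).real B) ^ n := by
  have hset : {a | ∀ k ∈ Finset.range n, X k a ∉ B} = ⋂ k ∈ Finset.range n, X k ⁻¹' Bᶜ := by
    ext; simp
  rw [hset, measureReal_def,
    hindep.measure_inter_preimage_eq_mul (Finset.range n) (sets := fun _ => Bᶜ)
      fun k _ => hB.compl]
  have : ∀ k ∈ Finset.range n, P (X k ⁻¹' Bᶜ) = (volume : Measure UnitAddCircle) Bᶜ :=
    fun k _ => by rw [← hunif k, Measure.map_apply (hmeas k) hB.compl]
  rw [Finset.prod_congr rfl this]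
  simp only [Finset.prod_const, Finset.card_range, ENNReal.toReal_pow]
  rw [← measureReal_def, probReal_compl_eq_one_sub hB]

lemma UnitAddCircle.volumeReal_closedBall (t : UnitAddCircle) {r : ℝ} (hr : 0 ≤ r)
    (hr' : 2 * r ≤ 1) : (volume : Measure UnitAddCircle).real (Metric.closedBall t r) = 2 * r := by
  rw [measureReal_def, AddCircle.volume_closedBall, min_eq_right hr',
    ENNReal.toReal_ofReal (by positivity)]

lemma UnitAddCircle.volumeReal_ball (t : UnitAddCircle) {r : ℝ} (hr : 0 ≤ r)
    (hr' : 2 * r ≤ 1) : (volume : Measure UnitAddCircle).real (Metric.ball t r) = 2 * r := by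
  rw [← UnitAddCircle.volumeReal_closedBall t hr hr']
  exact measureReal_congr AddCircle.closedBall_ae_eq_ball.symm

/-- A finite `2r`-separated set is unlikely to be covered by `n` uniform closed arcs of radius `r`
when its cardinality is large. -/
lemma measureReal_covered_mul_le_one [IsProbabilityMeasure P]
    (hmeas : ∀ n, Measurable (X n)) (hindep : iIndepFun X P)
    (hunif : ∀ n, P.map (X n) = volume) (n : ℕ) {r : ℝ} (hr : 0 ≤ r) (hr' : 2 * r ≤ 1)
    (D : Finset UnitAddCircle) (hD : ∀ t ∈ D, ∀ u ∈ D, t ≠ u → 2 * r < dist t u) :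
    P.real {a | ∀ t ∈ D, ∃ k ∈ Finset.range n, t ∈ Metric.closedBall (X k a) r} *
      (D.card * (1 - 2 * r) ^ n) ≤ 1 := by
  have hset : {a | ∀ t ∈ D, ∃ k ∈ Finset.range n, t ∈ Metric.closedBall (X k a) r} =
      ⋂ t ∈ D, {a | ∀ k ∈ Finset.range n, X k a ∉ Metric.closedBall t r}ᶜ := by
    ext a
    simp [dist_comm]
  rw [hset]
  refine measureReal_iInter_compl_mul_le_one P D _
    (fun t _ => measurableSet_forall_range_notMem hmeas n Metric.isClosed_closedBall.measurableSet)
    _ (fun t _ => ?_) (fun t ht u hu htu => ?_)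
  · rw [measureReal_forall_range_notMem hmeas hindep hunif n
      Metric.isClosed_closedBall.measurableSet, UnitAddCircle.volumeReal_closedBall t hr hr']
  · have hinter : {a | ∀ k ∈ Finset.range n, X k a ∉ Metric.closedBall t r} ∩
        {a | ∀ k ∈ Finset.range n, X k a ∉ Metric.closedBall u r} =
        {a | ∀ k ∈ Finset.range n, X k a ∉ Metric.closedBall t r ∪ Metric.closedBall u r} := by
      ext a
      simp only [Set.mem_inter_iff, Set.mem_ofPred_eq, Set.mem_union, not_or, ← forall₂_and]
    have hvol : (volume : Measure UnitAddCircle).real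
        (Metric.closedBall t r ∪ Metric.closedBall u r) = 2 * r + 2 * r := by
      rw [measureReal_union (Metric.closedBall_disjoint_closedBall
        (by linarith [hD t ht u hu htu])) Metric.isClosed_closedBall.measurableSet,
        UnitAddCircle.volumeReal_closedBall t hr hr', UnitAddCircle.volumeReal_closedBall u hr hr']
    have hle := measureReal_le_one (μ := (volume : Measure UnitAddCircle))
      (s := Metric.closedBall t r ∪ Metric.closedBall u r)
    rw [hinter, measureReal_forall_range_notMem hmeas hindep hunif n
      (Metric.isClosed_closedBall.measurableSet.union Metric.isClosed_closedBall.measurableSet),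
      hvol, ← pow_mul, mul_comm n 2, pow_mul]
    -- Non-positive correlation is `1 - 4 r ≤ (1 - 2 r) ^ 2`. The base `1 - 4 r` is nonnegative
    -- because two disjoint arcs have total length at most `1`.
    refine pow_le_pow_left₀ (by linarith) ?_ n
    nlinarith [sq_nonneg r]

end UniformPoints

/-! ### Hausdorff dimension and packing numbers -/

/-- The Hausdorff dimension is at most the lower box dimension, in terms of packing numbers along a
sequence of scales. -/
lemma dimH_le_of_eventually_packingNumber_le {T : Type*} [EMetricSpace T] {B : Set T} {s : ℝ≥0}
    {ε : ℕ → ℝ≥0} (hε : Tendsto ε atTop (𝓝 0))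
    (hfin : ∀ᶠ n in atTop, Metric.packingNumber (ε n) B ≠ ⊤)
    (hle : ∀ᶠ n in atTop, (Metric.packingNumber (ε n) B : ℝ≥0∞) * (2 * ε n) ^ (s : ℝ) ≤ 1) :
    dimH B ≤ s := by
  borelize T
  refine dimH_le_of_hausdorffMeasure_ne_top (ne_top_of_le_ne_top ENNReal.one_ne_top ?_)
  have hfs : ∀ n, (Metric.maximalSeparatedSet (ε n) B).Finite := by
    intro n
    by_cases h : Metric.packingNumber (ε n) B = ⊤
    -- When the packing number is infinite, `Metric.maximalSeparatedSet` takes its default value,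
    -- the empty set.
    · simp [Metric.maximalSeparatedSet, h]
    · exact Set.encard_ne_top_iff.1 (Metric.encard_maximalSeparatedSet h ▸ h)
  have : ∀ n, Fintype (Metric.maximalSeparatedSet (ε n) B) := fun n => (hfs n).fintype
  have hdiam : ∀ n (i : Metric.maximalSeparatedSet (ε n) B),
      Metric.ediam (Metric.closedEBall (i : T) (ε n)) ≤ 2 * ε n := fun n i =>
    Metric.ediam_closedEBall_le
  refine (Measure.hausdorffMeasure_le_liminf_sum (l := atTop) s B (fun n => 2 * ε n) ?_
    (fun n (i : Metric.maximalSeparatedSet (ε n) B) => Metric.closedEBall (i : T) (ε n))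
    (Eventually.of_forall hdiam) ?_).trans ?_
  · have : Tendsto (fun n => (ε n : ℝ≥0∞)) atTop (𝓝 ((0 : ℝ≥0) : ℝ≥0∞)) :=
      ENNReal.tendsto_coe.2 hε
    simpa using ENNReal.Tendsto.const_mul this (Or.inr (by simp : (2 : ℝ≥0∞) ≠ ⊤))
  · filter_upwards [hfin] with n hn x hx
    obtain ⟨y, hy, hxy⟩ := Metric.isCover_maximalSeparatedSet hn hx
    exact Set.mem_iUnion.2 ⟨⟨y, hy⟩, hxy⟩
  · refine liminf_le_of_frequently_le' (Eventually.frequently ?_)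
    filter_upwards [hfin, hle] with n hn hn'
    refine le_trans ?_ hn'
    calc ∑ i : Metric.maximalSeparatedSet (ε n) B,
          Metric.ediam (Metric.closedEBall (i : T) (ε n)) ^ (s : ℝ)
        ≤ ∑ i : Metric.maximalSeparatedSet (ε n) B, (2 * (ε n : ℝ≥0∞)) ^ (s : ℝ) :=
          Finset.sum_le_sum fun i _ => ENNReal.rpow_le_rpow (hdiam n i) s.2
      _ = _ := by
          rw [← Metric.encard_maximalSeparatedSet hn, ← (hfs n).cast_ncard_eq, Finset.sum_const,
            nsmul_eq_mul, Finset.card_univ, ← Nat.card_eq_fintype_card, Nat.card_coe_set_eq,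
            ENat.toENNReal_coe]

/-! ### Asymptotics of the lengths -/

lemma logLength_nonneg {c : ℝ} (hc : 0 ≤ c) (n : ℕ) : 0 ≤ logLength c n :=
  div_nonneg (mul_nonneg hc (Real.log_natCast_nonneg n)) n.cast_nonneg

lemma tendsto_logLength (c : ℝ) : Tendsto (logLength c) atTop (𝓝 0) := by
  have h : Tendsto (fun x : ℝ => Real.log x / x) atTop (𝓝 0) := by
    simpa using Real.tendsto_pow_log_div_mul_add_atTop 1 0 1 one_ne_zero
  have := ((h.comp tendsto_natCast_atTop_atTop).const_mul c)
  simp only [mul_zero] at this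
  refine this.congr fun n => ?_
  simp [logLength, mul_div_assoc]

/-- `(1 - ℓ_n) ^ n` decays more slowly than `n ^ (-c')` for every `c' > c`. -/
lemma eventually_rpow_neg_le_one_sub_logLength_pow {c c' : ℝ} (hc : 0 < c) (hcc' : c < c') :
    ∀ᶠ n : ℕ in atTop, (n : ℝ) ^ (-c') ≤ (1 - logLength c n) ^ n := by
  -- This threshold makes `c / (1 - ℓ n) ≤ c'`, which absorbs the error in `log (1 - u) ≥ -u / (1 -
  -- u)`.
  have h1 : ∀ᶠ n in atTop, logLength c n < 1 - c / c' :=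
    (tendsto_logLength c).eventually_lt_const (by
      rw [sub_pos, div_lt_one (hc.trans hcc')]; exact hcc')
  filter_upwards [h1, eventually_ge_atTop 1] with n hn hn1
  have hc' : 0 < c' := hc.trans hcc'
  have hpos : 0 < 1 - logLength c n := by
    have : 0 < c / c' := div_pos hc hc'
    linarith
  have hn0 : (0 : ℝ) < n := by exact_mod_cast hn1
  have hlog0 : 0 ≤ Real.log n := Real.log_natCast_nonneg n
  rw [Real.rpow_def_of_pos hn0, ← Real.exp_log (pow_pos hpos n), Real.exp_le_exp, Real.log_pow]
  have hlog : 1 - (1 - logLength c n)⁻¹ ≤ Real.log (1 - logLength c n) :=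
    Real.one_sub_inv_le_log_of_pos hpos
  have hinv : (1 - logLength c n)⁻¹ - 1 = logLength c n * (1 - logLength c n)⁻¹ := by
    field_simp
    ring
  have hbound : c * (1 - logLength c n)⁻¹ ≤ c' := by
    rw [← div_eq_mul_inv, div_le_iff₀ hpos]
    have : c' * (c / c') = c := by field_simp
    nlinarith
  have hnl : n * logLength c n = c * Real.log n := by
    rw [logLength]; field_simp
  calc Real.log n * -c' ≤ -(c * (1 - logLength c n)⁻¹ * Real.log n) := by nlinarith
    _ = n * (1 - (1 - logLength c n)⁻¹) := by
        have : (1 : ℝ) - (1 - logLength c n)⁻¹ = -(logLength c n * (1 - logLength c n)⁻¹) := by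
          linarith
        rw [this]
        linear_combination (1 - logLength c n)⁻¹ * hnl
    _ ≤ _ := by gcongr

/-- The product is a constant times `(log n) ^ s / n ^ (s - c')`. It bounds the Hausdorff sums of
exponent `s` when there are `O(n ^ c')` balls of radius `ℓ n`. -/
lemma tendsto_rpow_mul_logLength_rpow {c c' s : ℝ} (hc : 0 ≤ c) (hs : c' < s) (C : ℝ) :
    Tendsto (fun n : ℕ => C * (n : ℝ) ^ c' * (2 * logLength c n) ^ s) atTop (𝓝 0) := by
  have h : Tendsto (fun x : ℝ => Real.log x ^ s / x ^ (s - c')) atTop (𝓝 0) :=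
    (isLittleO_log_rpow_rpow_atTop s (sub_pos.2 hs)).tendsto_div_nhds_zero
  have := (h.comp tendsto_natCast_atTop_atTop).const_mul (C * (2 * c) ^ s)
  rw [mul_zero] at this
  refine this.congr' ?_
  filter_upwards [eventually_ge_atTop 1] with n hn
  have hn0 : (0 : ℝ) < n := by exact_mod_cast hn
  have : 2 * logLength c n = (2 * c) * Real.log n / n := by rw [logLength]; ring
  rw [this, Real.div_rpow (mul_nonneg (by positivity) (Real.log_natCast_nonneg n)) hn0.le,
    Real.mul_rpow (by positivity) (Real.log_natCast_nonneg n), Function.comp_apply,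
    Real.rpow_sub hn0]
  have := Real.rpow_pos_of_pos hn0 c'
  have := Real.rpow_pos_of_pos hn0 s
  field_simp

/-! ### Capacitability of analytic sets -/

/-- The image of `{y | ∀ i, y i ≤ m i}` under a continuous map contains the intersection of the
closures of the images of the sets `{y | ∀ i < k, y i ≤ m i}`. -/
lemma iInter_closure_image_subset_image_le {X : Type*} [TopologicalSpace X] [T2Space X]
    {f : (ℕ → ℕ) → X} (hf : Continuous f) (m : ℕ → ℕ) :
    ⋂ k, closure (f '' {y | ∀ i < k, y i ≤ m i}) ⊆ f '' {y | ∀ i, y i ≤ m i} := by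
  intro z hz
  by_contra hzK
  have hcomp : IsCompact {y : ℕ → ℕ | ∀ i, y i ≤ m i} := by
    have : {y : ℕ → ℕ | ∀ i, y i ≤ m i} = Set.univ.pi fun i => Set.Iic (m i) := by
      ext; simp [Pi.le_def]
    rw [this]
    exact isCompact_univ_pi fun i => (Set.finite_Iic (m i)).isCompact
  obtain ⟨U, V, hU, hV, hzU, hKV, hUV⟩ := SeparatedNhds.of_isCompact_isCompact
    (isCompact_singleton (x := z)) (hcomp.image hf) (Set.disjoint_singleton_left.2 hzK)
  have hzU : z ∈ U := hzU rfl
  have hloc : ∀ y ∈ {y : ℕ → ℕ | ∀ i, y i ≤ m i}, ∃ k, PiNat.cylinder y k ⊆ f ⁻¹' V := by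
    intro y hy
    have hmem : f ⁻¹' V ∈ 𝓝 y := (hV.preimage hf).mem_nhds (hKV ⟨y, hy, rfl⟩)
    obtain ⟨s, ⟨x, n, rfl⟩, hys, hs⟩ :=
      (PiNat.isTopologicalBasis_cylinders (fun _ : ℕ => ℕ)).mem_nhds_iff.1 hmem
    exact ⟨n, (PiNat.mem_cylinder_iff_eq.1 hys).trans_subset hs⟩
  choose! κ hκ using hloc
  obtain ⟨F, hFK, hF⟩ := hcomp.elim_nhds_subcover (fun y => PiNat.cylinder y (κ y))
    fun y _ => (PiNat.isOpen_cylinder _ y _).mem_nhds (PiNat.self_mem_cylinder _ _)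
  set k := F.sup κ
  have hsub : f '' {y | ∀ i < k, y i ≤ m i} ⊆ V := by
    rintro _ ⟨y, hy, rfl⟩
    -- Truncating `y` at `m` gives a point of the compact set that agrees with `y` below `k`, so
    -- both lie in the same cylinder of the finite subcover.
    have hmin : (fun i => min (y i) (m i)) ∈ {y : ℕ → ℕ | ∀ i, y i ≤ m i} :=
      fun i => min_le_right _ _
    obtain ⟨w, hw, hyw⟩ := Set.mem_iUnion₂.1 (hF hmin)
    refine hκ w (hFK w hw) fun i hi => ?_
    rw [← hyw i hi]
    exact (min_eq_left (hy i (hi.trans_le (Finset.le_sup hw)))).symm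
  obtain ⟨x, hxU, hx⟩ := mem_closure_iff.1 (Set.mem_iInter.1 hz k) U hU hzU
  exact Set.disjoint_left.1 hUV hxU (hsub hx)

/-- Capacitability: the outer measure of an analytic set is approximated by compact subsets. -/
theorem MeasureTheory.AnalyticSet.exists_isCompact_measure_le_add {X : Type*} [TopologicalSpace X]
    [T2Space X] [MeasurableSpace X] [OpensMeasurableSpace X] (ν : Measure X)
    [IsFiniteMeasure ν] {C : Set X} (hC : AnalyticSet C) {ε : ℝ≥0∞} (hε : ε ≠ 0) :
    ∃ K ⊆ C, IsCompact K ∧ ν C ≤ ν K + ε := by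
  rw [AnalyticSet] at hC
  rcases hC with rfl | ⟨f, hf, rfl⟩
  · exact ⟨∅, subset_rfl, isCompact_empty, by simp⟩
  rcases eq_or_ne (ν (Set.range f)) 0 with h0 | h0
  · exact ⟨∅, Set.empty_subset _, isCompact_empty, by simp [h0]⟩
  -- `c < ν (range f)` is the level which all truncations have to exceed
  set c := ν (Set.range f) - ε with hc
  have hcε : ν (Set.range f) ≤ c + ε := le_tsub_add
  have hclt : c < ν (Set.range f) := ENNReal.sub_lt_self (measure_ne_top _ _) h0 hε
  have hstep : ∀ (k : ℕ) (m : ℕ → ℕ), c < ν (f '' {y | ∀ i < k, y i ≤ m i}) →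
      ∃ b, c < ν (f '' {y | (∀ i < k, y i ≤ m i) ∧ y k ≤ b}) := by
    intro k m h
    have hun : f '' {y | ∀ i < k, y i ≤ m i} =
        ⋃ b, f '' {y | (∀ i < k, y i ≤ m i) ∧ y k ≤ b} := by
      rw [← Set.image_iUnion]
      congr 1
      ext y
      simp only [Set.mem_ofPred_eq, Set.mem_iUnion, exists_and_left]
      exact ⟨fun h => ⟨h, y k, le_rfl⟩, fun h => h.1⟩
    have hmono : Monotone fun b => f '' {y | (∀ i < k, y i ≤ m i) ∧ y k ≤ b} :=
      fun b b' hb => Set.image_mono fun y hy => ⟨hy.1, hy.2.trans hb⟩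
    -- Continuity from below holds for the outer measure of arbitrary sets; these images need not be
    -- measurable.
    rw [hun, hmono.measure_iUnion] at h
    exact lt_iSup_iff.1 h
  choose! g hg using hstep
  -- the sequence of bounds, built from its initial segments
  let M : ℕ → (ℕ → ℕ) := fun k => Nat.rec (fun _ => 0) (fun k m => Function.update m k (g k m)) k
  have hM : ∀ k, M (k + 1) = Function.update (M k) k (g k (M k)) := fun k => rfl
  let m : ℕ → ℕ := fun i => M (i + 1) i
  have hMm : ∀ k, ∀ i < k, M k i = m i := by
    intro k
    induction k with
    | zero => intro i hi; omega
    | succ k ih =>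
      intro i hi
      rcases Nat.lt_succ_iff_lt_or_eq.1 hi with h | rfl
      · rw [hM, Function.update_of_ne h.ne, ih i h]
      · rfl
  have hlt : ∀ k, c < ν (f '' {y | ∀ i < k, y i ≤ m i}) := by
    intro k
    induction k with
    | zero => simpa using hclt
    | succ k ih =>
      have hset : {y : ℕ → ℕ | ∀ i < k, y i ≤ m i} = {y | ∀ i < k, y i ≤ M k i} := by
        ext y
        exact forall₂_congr fun i hi => by rw [hMm k i hi]
      rw [hset] at ih
      have h := hg k (M k) ih
      have hmk : m k = g k (M k) := by simp [m, hM]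
      refine h.trans_le (measure_mono (Set.image_mono ?_))
      rintro y ⟨hy, hyk⟩ i hi
      rcases Nat.lt_succ_iff_lt_or_eq.1 hi with h | rfl
      · exact hMm k i h ▸ hy i h
      · exact hmk ▸ hyk
  refine ⟨f '' {y | ∀ i, y i ≤ m i}, Set.image_subset_range _ _, ?_, ?_⟩
  · have : {y : ℕ → ℕ | ∀ i, y i ≤ m i} = Set.univ.pi fun i => Set.Iic (m i) := by
      ext; simp [Pi.le_def]
    rw [this]
    exact (isCompact_univ_pi fun i => (Set.finite_Iic (m i)).isCompact).image hf
  · refine hcε.trans (add_le_add_left ?_ _)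
    have hanti : Antitone fun k => closure (f '' {y | ∀ i < k, y i ≤ m i}) :=
      fun k l hkl => closure_mono (Set.image_mono fun y hy i hi => hy i (hi.trans_le hkl))
    refine le_trans ?_ (measure_mono (iInter_closure_image_subset_image_le hf m))
    -- Continuity from above does need measurability, which is why the images are replaced by their
    -- closures.
    rw [hanti.measure_iInter (fun k => isClosed_closure.measurableSet.nullMeasurableSet)
      ⟨0, measure_ne_top _ _⟩]
    exact le_iInf fun k => (hlt k).le.trans (measure_mono subset_closure)

/-! ### Dimension of a set covered on a single event -/

lemma Metric.packingNumber_le_of_forall_finset {T : Type*} [PseudoEMetricSpace T] {B : Set T}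
    {ε : ℝ≥0} {M : ℕ}
    (h : ∀ D : Finset T, (D : Set T) ⊆ B → Metric.IsSeparated (ε : ℝ≥0∞) (D : Set T) → D.card ≤ M) :
    Metric.packingNumber ε B ≤ M := by
  refine iSup₂_le fun C hCB => iSup_le fun hC => ?_
  by_contra! hlt
  obtain ⟨t, htC, ht⟩ := Set.exists_subset_encard_eq (s := C) (k := (M + 1 : ℕ))
    (by push_cast; exact Order.add_one_le_of_lt hlt)
  have hfin : t.Finite := Set.finite_of_encard_eq_coe ht
  have hcard := h hfin.toFinset (by simpa using htC.trans hCB)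
    (by simpa using hC.subset htC)
  rw [hfin.encard_eq_coe_toFinset_card] at ht
  have : hfin.toFinset.card = M + 1 := by exact_mod_cast ht
  omega

/-- A set which, on an event of positive probability, is covered at all large stages has Hausdorff
dimension at most `c`. -/
lemma dimH_le_of_forall_mem_closedBall {Ω : Type*} [MeasurableSpace Ω] {P : Measure Ω}
    [IsProbabilityMeasure P] {X : ℕ → Ω → UnitAddCircle} (hmeas : ∀ n, Measurable (X n))
    (hindep : iIndepFun X P) (hunif : ∀ n, P.map (X n) = volume) {c : ℝ} (hc : 0 < c)
    {G : Set Ω} (hG : P G ≠ 0) {B : Set UnitAddCircle} (N : ℕ)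
    (hB : ∀ a ∈ G, ∀ n ≥ N, ∀ t ∈ B, ∃ k ∈ Finset.range n,
      t ∈ Metric.closedBall (X k a) (logLength c n / 2)) :
    dimH B ≤ ENNReal.ofReal c := by
  by_contra! hlt
  obtain ⟨s, hcs, hsB⟩ := ENNReal.lt_iff_exists_nnreal_btwn.1 hlt
  have hcs : c < s := by
    rwa [← ENNReal.ofReal_coe_nnreal, ENNReal.ofReal_lt_ofReal_iff_of_nonneg hc.le] at hcs
  refine hsB.not_ge ?_
  obtain ⟨c', hcc', hc's⟩ := exists_between hcs
  set q := P.real G with hq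
  have hq0 : 0 < q := ENNReal.toReal_pos hG (measure_ne_top _ _)
  -- Points more than `ℓ n` apart have disjoint closed arcs of radius `ℓ n / 2`, as the second
  -- moment bound requires.
  set ε : ℕ → ℝ≥0 := fun n => ⟨logLength c n, logLength_nonneg hc.le n⟩ with hε
  have hpack : ∀ᶠ n : ℕ in atTop,
      Metric.packingNumber (ε n) B ≤ (⌊q⁻¹ * (n : ℝ) ^ c'⌋₊ : ℕ) := by
    filter_upwards [eventually_rpow_neg_le_one_sub_logLength_pow hc hcc',
      (tendsto_logLength c).eventually_le_const one_pos, eventually_ge_atTop (max N 1)]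
      with n hn hn1 hnN
    refine Metric.packingNumber_le_of_forall_finset fun D hDB hD => Nat.le_floor ?_
    have hn0 : (0 : ℝ) < n := by exact_mod_cast (le_max_right N 1).trans hnN
    have hcov := measureReal_covered_mul_le_one hmeas hindep hunif n (r := logLength c n / 2)
      (by linarith [logLength_nonneg hc.le n]) (by linarith) D (fun t ht u hu htu => by
        have : (ε n : ℝ≥0∞) < edist t u := hD ht hu htu
        rw [edist_dist, ← ENNReal.ofReal_coe_nnreal, ENNReal.ofReal_lt_ofReal_iff_of_nonneg
          (ε n).coe_nonneg] at this
        linarith [show ((ε n : ℝ≥0) : ℝ) = logLength c n from rfl])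
    rw [mul_div_cancel₀ _ two_ne_zero] at hcov
    have hqle : q ≤ P.real {a | ∀ t ∈ D, ∃ k ∈ Finset.range n,
        t ∈ Metric.closedBall (X k a) (logLength c n / 2)} :=
      measureReal_mono fun a ha t ht => hB a ha n ((le_max_left N 1).trans hnN) t (hDB ht)
    have hpos : 0 < (n : ℝ) ^ (-c') := Real.rpow_pos_of_pos hn0 _
    have h1 : q * (D.card * (n : ℝ) ^ (-c')) ≤ 1 := le_trans (by gcongr) hcov
    rw [Real.rpow_neg hn0.le] at h1
    have hpos' : 0 < (n : ℝ) ^ c' := Real.rpow_pos_of_pos hn0 _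
    field_simp at h1 ⊢
    linarith
  refine dimH_le_of_eventually_packingNumber_le (ε := ε) ?_ ?_ ?_
  · rw [← NNReal.tendsto_coe]
    exact tendsto_logLength c
  · filter_upwards [hpack] with n hn
    exact ne_top_of_le_ne_top (ENat.natCast_ne_top _) hn
  · filter_upwards [hpack, (tendsto_rpow_mul_logLength_rpow (c' := c') hc.le hc's
      q⁻¹).eventually_le_const one_pos] with n hn hn1
    have h2 : (2 * (ε n : ℝ≥0∞)) ^ (s : ℝ) = ENNReal.ofReal ((2 * logLength c n) ^ (s : ℝ)) := by
      have hcoe : (ε n : ℝ≥0∞) = ENNReal.ofReal (logLength c n) :=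
        (ENNReal.ofReal_coe_nnreal (p := ε n)).symm
      rw [← ENNReal.ofReal_rpow_of_nonneg
        (mul_nonneg zero_le_two (logLength_nonneg hc.le n)) s.coe_nonneg,
        ENNReal.ofReal_mul zero_le_two, hcoe, ENNReal.ofReal_ofNat]
    have h3 : (Metric.packingNumber (ε n) B : ℝ≥0∞) ≤ ENNReal.ofReal (q⁻¹ * (n : ℝ) ^ c') := by
      calc (Metric.packingNumber (ε n) B : ℝ≥0∞)
          ≤ (((⌊q⁻¹ * (n : ℝ) ^ c'⌋₊ : ℕ) : ℕ∞) : ℝ≥0∞) := ENat.toENNReal_le.2 hn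
        _ = ENNReal.ofReal (⌊q⁻¹ * (n : ℝ) ^ c'⌋₊ : ℕ) := by simp
        _ ≤ _ := ENNReal.ofReal_le_ofReal (Nat.floor_le (by positivity))
    rw [h2]
    calc _ ≤ ENNReal.ofReal (q⁻¹ * (n : ℝ) ^ c') *
          ENNReal.ofReal ((2 * logLength c n) ^ (s : ℝ)) := by gcongr
      _ = ENNReal.ofReal (q⁻¹ * (n : ℝ) ^ c' * (2 * logLength c n) ^ (s : ℝ)) :=
          (ENNReal.ofReal_mul (by positivity)).symm
      _ ≤ 1 := by rw [← ENNReal.ofReal_one]; exact ENNReal.ofReal_le_ofReal hn1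

/-! ### Baire category on the support of a measure -/

/-- A compact set of positive measure carries a countable family of subsets of positive measure
such that each countable closed cover of the compact set has a member that contains a set of the
family. -/
lemma IsCompact.exists_countable_family_subset_of_closed_cover {Y : Type*} [TopologicalSpace Y]
    [T2Space Y] [SecondCountableTopology Y] [MeasurableSpace Y] [OpensMeasurableSpace Y]
    {ν : Measure Y} {S : Set Y} (hS : IsCompact S) (hS0 : ν S ≠ 0) :
    ∃ 𝒱 : Set (Set Y), 𝒱.Countable ∧ (∀ V ∈ 𝒱, V ⊆ S ∧ MeasurableSet V ∧ ν V ≠ 0) ∧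
      ∀ C : ℕ → Set Y, (∀ N, IsClosed (C N)) → S ⊆ ⋃ N, C N → ∃ V ∈ 𝒱, ∃ N, V ⊆ C N := by
  set b := TopologicalSpace.countableBasis Y with hb
  have hbc : b.Countable := TopologicalSpace.countable_countableBasis Y
  have hbb : TopologicalSpace.IsTopologicalBasis b := TopologicalSpace.isBasis_countableBasis Y
  -- Removing the basic open sets that meet `S` in a null set leaves the support `S₀` of `ν`
  -- restricted to `S`: every nonempty relatively open piece of `S₀` has positive measure.
  set W : Set Y := ⋃ u ∈ {u ∈ b | ν (S ∩ u) = 0}, u with hW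
  have hWo : IsOpen W := isOpen_biUnion fun u hu => hbb.isOpen hu.1
  have hWnull : ν (S ∩ W) = 0 := by
    rw [hW, Set.inter_iUnion₂]
    exact (measure_biUnion_null_iff (hbc.mono (Set.sep_subset _ _))).2 fun u hu => hu.2
  set S₀ := S \ W with hS₀
  have hcomp : IsCompact S₀ := hS.diff hWo
  have hS₀u : ∀ u, ν (S ∩ u) ≤ ν (S₀ ∩ u) := by
    intro u
    calc ν (S ∩ u) ≤ ν ((S₀ ∩ u) ∪ (S ∩ W)) := measure_mono fun x hx => by
          by_cases hxW : x ∈ W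
          · exact Or.inr ⟨hx.1, hxW⟩
          · exact Or.inl ⟨⟨hx.1, hxW⟩, hx.2⟩
      _ ≤ ν (S₀ ∩ u) + ν (S ∩ W) := measure_union_le _ _
      _ = ν (S₀ ∩ u) := by rw [hWnull, add_zero]
  refine ⟨(fun u => S₀ ∩ u) '' {u ∈ b | (S₀ ∩ u).Nonempty},
    (hbc.mono (Set.sep_subset _ _)).image _, ?_, ?_⟩
  · rintro _ ⟨u, ⟨hub, x, hxS, hxu⟩, rfl⟩
    refine ⟨Set.inter_subset_left.trans Set.sdiff_subset,
      hcomp.measurableSet.inter (hbb.isOpen hub).measurableSet, fun h0 => ?_⟩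
    exact hxS.2 (Set.mem_biUnion (show u ∈ {u ∈ b | ν (S ∩ u) = 0} from
      ⟨hub, le_antisymm ((hS₀u u).trans h0.le) bot_le⟩) hxu)
  · intro C hC hSC
    have hne : S₀.Nonempty := by
      by_contra! h
      have := hS₀u Set.univ
      rw [h] at this
      simp at this
      exact hS0 this
    have : Nonempty S₀ := hne.to_subtype
    have : CompactSpace S₀ := isCompact_iff_compactSpace.1 hcomp
    -- Baire's theorem in the compact space `S₀`: one closed set of the cover contains a relatively
    -- open piece, hence a basic one.
    obtain ⟨N, ⟨x, hxS⟩, hx⟩ := nonempty_interior_of_iUnion_of_closed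
      (f := fun N => ((↑) : S₀ → Y) ⁻¹' C N) (fun N => (hC N).preimage continuous_subtype_val)
      (by
        rw [← Set.preimage_iUnion]
        exact Set.eq_univ_of_forall fun x => hSC x.2.1)
    obtain ⟨O, hO, hOi⟩ := isOpen_induced_iff.1 (isOpen_interior
      (s := ((↑) : S₀ → Y) ⁻¹' C N))
    have hxO : x ∈ O := by
      have : (⟨x, hxS⟩ : S₀) ∈ ((↑) : S₀ → Y) ⁻¹' O := hOi ▸ hx
      exact this
    obtain ⟨u, hub, hxu, huO⟩ := hbb.exists_subset_of_mem_open hxO hO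
    refine ⟨S₀ ∩ u, ⟨u, ⟨hub, x, hxS, hxu⟩, rfl⟩, N, ?_⟩
    rintro y ⟨hyS, hyu⟩
    have : (⟨y, hyS⟩ : S₀) ∈ interior (((↑) : S₀ → Y) ⁻¹' C N) := hOi ▸ huO hyu
    exact Set.mem_preimage.1 (interior_subset this)

/-! ### Non-covering below the Hausdorff dimension -/

lemma mem_coverStage {ℓ : ℕ → ℝ} {x : ℕ → UnitAddCircle} {n : ℕ} {t : UnitAddCircle} :
    t ∈ coverStage ℓ x n ↔ ∃ k ∈ Finset.range n, t ∈ Metric.ball (x k) (ℓ n / 2) := by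
  simp [coverStage]

lemma mem_uniformCover {ℓ : ℕ → ℝ} {x : ℕ → UnitAddCircle} {t : UnitAddCircle} :
    t ∈ uniformCover ℓ x ↔ ∀ᶠ n in atTop, t ∈ coverStage ℓ x n := by
  rw [uniformCover, mem_liminf_iff_eventually_mem]

/-- The inner measure of the set of sequences that uniformly cover `A` is zero when
`c < dimH A`. -/
theorem measure_eq_zero_of_subset_covering {Ω : Type*} [MeasurableSpace Ω] {P : Measure Ω}
    [IsProbabilityMeasure P] {X : ℕ → Ω → UnitAddCircle} (hmeas : ∀ n, Measurable (X n))
    (hindep : iIndepFun X P) (hunif : ∀ n, P.map (X n) = volume) {c : ℝ} (hc : 0 < c)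
    {A : Set UnitAddCircle} (hA : ENNReal.ofReal c < dimH A) {S : Set (ℕ → UnitAddCircle)}
    (hS : MeasurableSet S) (hSA : S ⊆ {x | A ⊆ uniformCover (logLength c) x}) :
    P {a | (fun n => X n a) ∈ S} = 0 := by
  by_contra hne
  have hξ : Measurable fun a n => X n a := measurable_pi_lambda _ hmeas
  set ν : Measure (ℕ → UnitAddCircle) := P.map fun a n => X n a with hν
  have : IsProbabilityMeasure ν := Measure.isProbabilityMeasure_map hξ.aemeasurable
  have hνS : 0 < ν S := by
    rw [hν, Measure.map_apply hξ hS]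
    exact pos_iff_ne_zero.2 hne
  obtain ⟨K, hKS, hK, hK0⟩ := hS.exists_lt_isCompact hνS
  obtain ⟨𝒱, h𝒱c, h𝒱, hcov⟩ := hK.exists_countable_family_subset_of_closed_cover hK0.ne'
  -- Closed arcs replace the open ones so that these sets are closed in the space of sequences, as
  -- Baire's theorem requires.
  set C : UnitAddCircle → ℕ → Set (ℕ → UnitAddCircle) := fun t N =>
    {x | ∀ n ≥ N, ∃ k ∈ Finset.range n, t ∈ Metric.closedBall (x k) (logLength c n / 2)} with hC
  have hCclosed : ∀ t N, IsClosed (C t N) := by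
    intro t N
    have : C t N = ⋂ n ≥ N, ⋃ k ∈ Finset.range n,
        {x : ℕ → UnitAddCircle | dist t (x k) ≤ logLength c n / 2} := by
      ext x
      simp [hC]
    rw [this]
    refine isClosed_biInter fun n _ => isClosed_biUnion_finset fun k _ => ?_
    exact isClosed_le (continuous_const.dist (continuous_apply k)) continuous_const
  set B : Set (ℕ → UnitAddCircle) → ℕ → Set UnitAddCircle := fun V N => {t | V ⊆ C t N} with hB
  have hAsub : A ⊆ ⋃ V ∈ 𝒱, ⋃ N, B V N := by
    intro t ht
    obtain ⟨V, hV, N, hVN⟩ := hcov (C t) (hCclosed t) fun x hx => by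
      obtain ⟨N, hN⟩ := eventually_atTop.1 (mem_uniformCover.1 (hSA (hKS hx) ht))
      refine Set.mem_iUnion.2 ⟨N, fun n hn => ?_⟩
      obtain ⟨k, hk, hkt⟩ := mem_coverStage.1 (hN n hn)
      exact ⟨k, hk, Metric.ball_subset_closedBall hkt⟩
    exact Set.mem_biUnion hV (Set.mem_iUnion.2 ⟨N, hVN⟩)
  refine hA.not_ge ((dimH_mono hAsub).trans ?_)
  rw [dimH_bUnion h𝒱c]
  refine iSup₂_le fun V hV => ?_
  rw [dimH_iUnion]
  refine iSup_le fun N => ?_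
  obtain ⟨-, hVm, hV0⟩ := h𝒱 V hV
  refine dimH_le_of_forall_mem_closedBall hmeas hindep hunif hc
    (G := (fun a n => X n a) ⁻¹' V) ?_ N ?_
  · rwa [← Measure.map_apply hξ hVm]
  · exact fun a ha n hn t ht => ht ha n hn

/-- This is the projection of the pairs `(x, t)` with `t ∈ A` and `t` outside the covered set. The
latter condition is Borel in the pair. -/
lemma analyticSet_not_subset_uniformCover {A : Set UnitAddCircle} (hA : AnalyticSet A)
    (ℓ : ℕ → ℝ) : AnalyticSet {x | ¬ A ⊆ uniformCover ℓ x} := by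
  have hmeas : MeasurableSet
      {p : (ℕ → UnitAddCircle) × UnitAddCircle | p.2 ∈ uniformCover ℓ p.1} := by
    have : {p : (ℕ → UnitAddCircle) × UnitAddCircle | p.2 ∈ uniformCover ℓ p.1} =
        ⋃ N, ⋂ n ≥ N, ⋃ k ∈ Finset.range n,
          {p : (ℕ → UnitAddCircle) × UnitAddCircle | dist p.2 (p.1 k) < ℓ n / 2} := by
      ext p
      simp [mem_uniformCover, mem_coverStage]
    rw [this]
    refine MeasurableSet.iUnion fun N => MeasurableSet.iInter fun n => MeasurableSet.iInter fun _ =>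
      (isOpen_biUnion fun k _ => ?_).measurableSet
    exact isOpen_lt (continuous_snd.dist ((continuous_apply k).comp continuous_fst))
      continuous_const
  have himage : {x | ¬ A ⊆ uniformCover ℓ x} =
      Prod.fst '' ⋂ i : Bool, cond i (Prod.snd ⁻¹' A)
        {p : (ℕ → UnitAddCircle) × UnitAddCircle | p.2 ∈ uniformCover ℓ p.1}ᶜ := by
    ext x
    simp [Set.not_subset, and_comm]
  rw [himage]
  refine (AnalyticSet.iInter fun i => ?_).image_of_continuous continuous_fst
  cases i
  · exact hmeas.compl.analyticSet
  · exact hA.preimage continuous_snd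

theorem measure_covering_eq_zero_of_analyticSet {Ω : Type*} [MeasurableSpace Ω] {P : Measure Ω}
    [IsProbabilityMeasure P] {X : ℕ → Ω → UnitAddCircle} (hmeas : ∀ n, Measurable (X n))
    (hindep : iIndepFun X P) (hunif : ∀ n, P.map (X n) = volume) {c : ℝ} (hc : 0 < c)
    {A : Set UnitAddCircle} (hA : ENNReal.ofReal c < dimH A) (hAan : AnalyticSet A) :
    P {a | A ⊆ uniformCover (logLength c) (fun n => X n a)} = 0 := by
  have hξ : Measurable fun a n => X n a := measurable_pi_lambda _ hmeas
  set ν : Measure (ℕ → UnitAddCircle) := P.map fun a n => X n a with hν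
  have : IsProbabilityMeasure ν := Measure.isProbabilityMeasure_map hξ.aemeasurable
  set C : Set (ℕ → UnitAddCircle) := {x | ¬ A ⊆ uniformCover (logLength c) x} with hC
  have hCan : AnalyticSet C := analyticSet_not_subset_uniformCover hAan _
  -- The complement of a measurable hull of `C` is a measurable set of covering sequences, hence
  -- null; so `C` has full outer measure.
  have hCone : ν C = 1 := by
    have hm := (measurableSet_toMeasurable ν C)
    have h0 : ν (toMeasurable ν C)ᶜ = 0 := by
      rw [hν, Measure.map_apply hξ hm.compl]
      refine measure_eq_zero_of_subset_covering hmeas hindep hunif hc hA hm.compl fun x hx => ?_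
      by_contra hxC
      exact hx (subset_toMeasurable ν C hxC)
    rw [← measure_toMeasurable]
    exact (prob_compl_eq_zero_iff hm).1 h0
  refine le_antisymm (ENNReal.le_of_forall_pos_le_add fun ε hε _ => ?_) bot_le
  obtain ⟨K, hKC, hK, hle⟩ := hCan.exists_isCompact_measure_le_add ν
    (ENNReal.coe_ne_zero.2 hε.ne')
  rw [zero_add]
  calc P {a | A ⊆ uniformCover (logLength c) (fun n => X n a)}
      ≤ P ((fun a n => X n a) ⁻¹' Kᶜ) := measure_mono fun a ha haK => hKC haK ha
    _ = ν Kᶜ := (Measure.map_apply hξ hK.measurableSet.compl).symm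
    _ = 1 - ν K := prob_compl_eq_one_sub hK.measurableSet
    _ ≤ ε := tsub_le_iff_left.2 (hCone ▸ hle)

/-! ### Covering above the upper box dimension -/

lemma eventually_externalCoveringNumber_le_rpow {T : Type*} [PseudoEMetricSpace T] {A : Set T}
    {d : ℝ} (h : upperBoxDim A < (d : EReal)) :
    ∀ᶠ ε : ℝ≥0 in 𝓝[>] 0,
      ((Metric.externalCoveringNumber ε A : ℕ∞) : ℝ≥0∞) < ENNReal.ofReal ((ε : ℝ) ^ (-d)) := by
  filter_upwards [eventually_lt_of_limsup_lt h, self_mem_nhdsWithin,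
    (eventually_lt_nhds (zero_lt_one : (0 : ℝ≥0) < 1)).filter_mono nhdsWithin_le_nhds]
    with ε hε hpos hlt
  have hpos : (0 : ℝ) < ε := hpos
  have hlt : (ε : ℝ) < 1 := hlt
  have hL : 0 < Real.log (1 / (ε : ℝ)) := Real.log_pos (by rwa [one_lt_div hpos])
  rw [EReal.div_lt_iff (EReal.coe_pos.2 hL) (EReal.coe_ne_top _)] at hε
  rw [← ENNReal.log_lt_log_iff, ENNReal.log_ofReal_of_pos (Real.rpow_pos_of_pos hpos _),
    Real.log_rpow hpos]
  convert hε using 1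
  rw [← EReal.coe_mul, one_div, Real.log_inv]
  ring_nf

lemma Metric.exists_isCover_encard_le {T : Type*} [PseudoEMetricSpace T] {A : Set T} {ε : ℝ≥0}
    (h : Metric.externalCoveringNumber ε A ≠ ⊤) :
    ∃ C : Finset T, Metric.IsCover ε A (C : Set T) ∧
      (C.card : ℕ∞) ≤ Metric.externalCoveringNumber ε A := by
  -- The infimum is attained: a cover with fewer than `N + 1` points, `N` finite, has at most `N`.
  have hlt : Metric.externalCoveringNumber ε A < Metric.externalCoveringNumber ε A + 1 :=
    (ENat.lt_add_one_iff h).2 le_rfl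
  nth_rw 1 [Metric.externalCoveringNumber] at hlt
  obtain ⟨C, hC⟩ := iInf_lt_iff.1 hlt
  obtain ⟨hCA, hC⟩ := iInf_lt_iff.1 hC
  have hle := (ENat.lt_add_one_iff h).1 hC
  have hfin : C.Finite := Set.encard_ne_top_iff.1 (ne_top_of_le_ne_top h hle)
  refine ⟨hfin.toFinset, by simpa using hCA, ?_⟩
  rwa [← hfin.encard_eq_coe_toFinset_card]

/-- First moment bound for the probability that some point of `A` is missed at stage `n`. -/
lemma measure_not_subset_coverStage_le {Ω : Type*} [MeasurableSpace Ω] {P : Measure Ω}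
    [IsProbabilityMeasure P] {X : ℕ → Ω → UnitAddCircle} (hmeas : ∀ n, Measurable (X n))
    (hindep : iIndepFun X P) (hunif : ∀ n, P.map (X n) = volume) {ℓ : ℕ → ℝ} {n : ℕ}
    {A : Set UnitAddCircle} {ε : ℝ≥0} (hε : 2 * (ε : ℝ) ≤ ℓ n) (hℓ : ℓ n ≤ 1)
    (hfin : Metric.externalCoveringNumber ε A ≠ ⊤) :
    P {a | ¬ A ⊆ coverStage ℓ (fun k => X k a) n} ≤
      (Metric.externalCoveringNumber ε A : ℝ≥0∞) *
        ENNReal.ofReal ((1 - (ℓ n - 2 * ε)) ^ n) := by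
  obtain ⟨C, hCA, hC⟩ := Metric.exists_isCover_encard_le hfin
  have hsub : {a | ¬ A ⊆ coverStage ℓ (fun k => X k a) n} ⊆
      -- If a point of the sequence lies within `ℓ n / 2 - ε` of the center `y`, its arc contains
      -- the whole closed `ε`-ball about `y`.
      ⋃ y ∈ C, {a | ∀ k ∈ Finset.range n, X k a ∉ Metric.ball y (ℓ n / 2 - ε)} := by
    intro a ha
    obtain ⟨t, htA, ht⟩ := Set.not_subset.1 ha
    obtain ⟨y, hy, hty⟩ := hCA htA
    refine Set.mem_biUnion hy fun k hk hkb => ht (mem_coverStage.2 ⟨k, hk, ?_⟩)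
    have hty : dist t y ≤ ε := by
      have : edist t y ≤ ε := hty
      rwa [edist_nndist, ENNReal.coe_le_coe, ← NNReal.coe_le_coe, coe_nndist] at this
    rw [Metric.mem_ball] at hkb ⊢
    linarith [dist_triangle t y (X k a), dist_comm y (X k a)]
  calc P {a | ¬ A ⊆ coverStage ℓ (fun k => X k a) n}
      ≤ ∑ y ∈ C, P {a | ∀ k ∈ Finset.range n, X k a ∉ Metric.ball y (ℓ n / 2 - ε)} :=
        (measure_mono hsub).trans (measure_biUnion_finset_le _ _)
    _ = ∑ y ∈ C, ENNReal.ofReal ((1 - (ℓ n - 2 * ε)) ^ n) := by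
        refine Finset.sum_congr rfl fun y _ => ?_
        rw [← ofReal_measureReal, measureReal_forall_range_notMem hmeas hindep hunif n
          Metric.isOpen_ball.measurableSet,
          UnitAddCircle.volumeReal_ball y (by linarith) (by linarith [ε.2])]
        ring_nf
    _ = (C.card : ℝ≥0∞) * ENNReal.ofReal ((1 - (ℓ n - 2 * ε)) ^ n) := by simp
    _ ≤ _ := by
        gcongr
        exact_mod_cast ENat.toENNReal_le.2 hC

lemma ae_eventually_notMem_of_eventually_measure_le {Ω : Type*} [MeasurableSpace Ω] {P : Measure Ω}
    {s : ℕ → Set Ω} {b : ℕ → ℝ} (hb : Summable b) (hb0 : ∀ n, 0 ≤ b n)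
    (hs : ∀ᶠ n in atTop, P (s n) ≤ ENNReal.ofReal (b n)) : ∀ᵐ a ∂P, ∀ᶠ n in atTop, a ∉ s n := by
  obtain ⟨N, hN⟩ := eventually_atTop.1 hs
  have hsum : ∑' n, P (s (n + N)) ≠ ∞ := by
    refine ne_top_of_le_ne_top ?_ (ENNReal.tsum_le_tsum fun n => hN (n + N) (Nat.le_add_left _ _))
    rw [← ENNReal.ofReal_tsum_of_nonneg (fun n => hb0 _) ((summable_nat_add_iff N).2 hb)]
    exact ENNReal.ofReal_ne_top
  filter_upwards [ae_eventually_notMem hsum] with a ha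
  rw [← map_add_atTop_eq_nat N]
  exact ha

theorem ae_subset_uniformCover {Ω : Type*} [MeasurableSpace Ω] {P : Measure Ω}
    [IsProbabilityMeasure P] {X : ℕ → Ω → UnitAddCircle} (hmeas : ∀ n, Measurable (X n))
    (hindep : iIndepFun X P) (hunif : ∀ n, P.map (X n) = volume) {c : ℝ} (hc : 0 < c)
    {A : Set UnitAddCircle} (hA : upperBoxDim A + 1 < (c : EReal)) :
    ∀ᵐ a ∂P, A ⊆ uniformCover (logLength c) (fun n => X n a) := by
  -- The empty set has dimension `-∞` and would allow `d < 0`. For nonempty `A` the covering number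
  -- is at least `1`, which forces `d ≥ 0`.
  rcases A.eq_empty_or_nonempty with rfl | hne
  · simp
  obtain ⟨d, hd, hdc⟩ : ∃ d : ℝ, upperBoxDim A < (d : EReal) ∧ d < c - 1 := by
    have h : upperBoxDim A < ((c - 1 : ℝ) : EReal) := by
      rw [EReal.coe_sub]
      exact (EReal.lt_sub_iff_add_lt (Or.inl (EReal.coe_ne_bot 1))
        (Or.inl (EReal.coe_ne_top 1))).2 hA
    obtain ⟨d, h1, h2⟩ := EReal.lt_iff_exists_real_btwn.1 h
    exact ⟨d, h1, EReal.coe_lt_coe_iff.1 h2⟩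
  have hcov := eventually_externalCoveringNumber_le_rpow hd
  have hd0 : 0 ≤ d := by
    by_contra! hneg
    obtain ⟨ε, hε, hlt⟩ := (hcov.and
      ((eventually_lt_nhds (zero_lt_one : (0 : ℝ≥0) < 1)).filter_mono nhdsWithin_le_nhds)).exists
    have h1 : (1 : ℝ≥0∞) ≤ ((Metric.externalCoveringNumber ε A : ℕ∞) : ℝ≥0∞) := by
      rw [← ENat.toENNReal_one, ENat.toENNReal_le]
      exact Order.one_le_iff_pos.2 (Metric.externalCoveringNumber_pos_iff.2 hne)
    refine (h1.trans_lt hε).not_ge (ENNReal.ofReal_le_one.2 ?_)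
    exact Real.rpow_le_one ε.2 (le_of_lt hlt) (by linarith)
  -- the radius of the auxiliary balls is a small multiple `δ` of the length
  obtain ⟨δ, hδ0, hδ, hδc⟩ : ∃ δ : ℝ, 0 < δ ∧ 2 * δ < 1 ∧ d - c * (1 - 2 * δ) < -1 := by
    -- With this `δ` the loss `2 * δ * c` is half of the gap `c - 1 - d`, so the final exponent
    -- stays below `-1`.
    refine ⟨(c - 1 - d) / (4 * c), by apply div_pos <;> linarith, ?_, ?_⟩
    · have : 2 * ((c - 1 - d) / (4 * c)) = (c - 1 - d) / (2 * c) := by field_simp; ring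
      rw [this, div_lt_one (by positivity)]
      linarith
    · have : c * (1 - 2 * ((c - 1 - d) / (4 * c))) = c - (c - 1 - d) / 2 := by field_simp; ring
      rw [this]
      linarith
  set ε : ℕ → ℝ≥0 := fun n =>
    ⟨δ * logLength c n, mul_nonneg hδ0.le (logLength_nonneg hc.le n)⟩ with hε
  have hεcoe : ∀ n, (ε n : ℝ) = δ * logLength c n := fun n => rfl
  have hεlim : Tendsto ε atTop (𝓝[>] 0) := by
    refine tendsto_nhdsWithin_iff.2 ⟨?_, ?_⟩
    · rw [← NNReal.tendsto_coe]
      simpa [hεcoe] using (tendsto_logLength c).const_mul δ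
    -- The radius must be strictly positive, and `log 1 = 0`.
    · filter_upwards [eventually_ge_atTop 2] with n hn
      have hn1 : (1 : ℝ) < n := by exact_mod_cast hn
      exact mul_pos hδ0 (div_pos (mul_pos hc (Real.log_pos hn1)) (by linarith))
  -- This says that `ε n ≥ 1 / n`, whence `ε n ^ (-d) ≤ n ^ d` because `d ≥ 0`.
  have hlarge : ∀ᶠ n : ℕ in atTop, 1 ≤ δ * c * Real.log n :=
    ((Real.tendsto_log_atTop.comp tendsto_natCast_atTop_atTop).const_mul_atTop
      (mul_pos hδ0 hc)).eventually_ge_atTop 1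
  have hbound : ∀ᶠ n : ℕ in atTop,
      P {a | ¬ A ⊆ coverStage (logLength c) (fun k => X k a) n} ≤
        ENNReal.ofReal ((n : ℝ) ^ (d - c * (1 - 2 * δ))) := by
    filter_upwards [hεlim.eventually hcov, (tendsto_logLength c).eventually_le_const one_pos,
      hlarge, eventually_ge_atTop 1] with n hn hn1 hlog hn2
    have hn0 : (0 : ℝ) < n := by exact_mod_cast hn2
    have hℓ0 := logLength_nonneg hc.le n
    have hfin : Metric.externalCoveringNumber (ε n) A ≠ ⊤ := fun h => by
      rw [h] at hn
      simp at hn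
    refine (measure_not_subset_coverStage_le hmeas hindep hunif (ℓ := logLength c) (ε := ε n)
      (by rw [hεcoe]; nlinarith) hn1 hfin).trans ?_
    have hN : ((ε n : ℝ)) ^ (-d) ≤ (n : ℝ) ^ d := by
      rw [hεcoe, Real.rpow_neg (mul_nonneg hδ0.le hℓ0), ← Real.inv_rpow (mul_nonneg hδ0.le hℓ0)]
      refine Real.rpow_le_rpow (by positivity) ?_ hd0
      rw [inv_le_comm₀ (by rw [logLength]; apply mul_pos hδ0; apply div_pos _ hn0; nlinarith) hn0,
        logLength, inv_eq_one_div, ← mul_div_assoc, ← mul_assoc]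
      gcongr
    have hpow : (1 - (logLength c n - 2 * ε n)) ^ n ≤ (n : ℝ) ^ (-(c * (1 - 2 * δ))) := by
      have hle : 1 - (logLength c n - 2 * ε n) ≤ Real.exp (-(logLength c n * (1 - 2 * δ))) := by
        rw [hεcoe]
        linarith [Real.add_one_le_exp (-(logLength c n * (1 - 2 * δ)))]
      calc (1 - (logLength c n - 2 * ε n)) ^ n
          ≤ Real.exp (-(logLength c n * (1 - 2 * δ))) ^ n :=
            pow_le_pow_left₀ (by linarith [(ε n).2]) hle n
        _ = (n : ℝ) ^ (-(c * (1 - 2 * δ))) := by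
            rw [← Real.exp_nat_mul, Real.rpow_def_of_pos hn0, logLength]
            congr 1
            field_simp
    calc _ ≤ ENNReal.ofReal ((n : ℝ) ^ d) * ENNReal.ofReal ((n : ℝ) ^ (-(c * (1 - 2 * δ)))) :=
          mul_le_mul' (hn.le.trans (ENNReal.ofReal_le_ofReal hN)) (ENNReal.ofReal_le_ofReal hpow)
      _ = ENNReal.ofReal ((n : ℝ) ^ (d - c * (1 - 2 * δ))) := by
          rw [← ENNReal.ofReal_mul (by positivity), ← Real.rpow_add hn0, ← sub_eq_add_neg]
  filter_upwards [ae_eventually_notMem_of_eventually_measure_le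
    (Real.summable_nat_rpow.2 hδc) (fun n => by positivity) hbound] with a ha t ht
  rw [mem_uniformCover]
  filter_upwards [ha] with n hn
  exact not_not.1 hn ht

theorem mainTheorem2 {Ω : Type*} [MeasurableSpace Ω] (P : Measure Ω) [IsProbabilityMeasure P]
    (X : ℕ → Ω → UnitAddCircle) (hmeas : ∀ n, Measurable (X n))
    (hindep : iIndepFun X P) (hunif : ∀ n, P.map (X n) = volume)
    (c : ℝ) (hc : 0 < c) (A : Set UnitAddCircle) :
    (upperBoxDim A + 1 < (c : EReal) →
      ∀ᵐ a ∂P, A ⊆ uniformCover (logLength c) (fun n => X n a)) ∧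
    (ENNReal.ofReal c < dimH A →
      (AnalyticSet A → P {a | A ⊆ uniformCover (logLength c) (fun n => X n a)} = 0) ∧
      (∀ S : Set (ℕ → UnitAddCircle), MeasurableSet S →
        S ⊆ {x | A ⊆ uniformCover (logLength c) x} → P {a | (fun n => X n a) ∈ S} = 0)) := by
  exact ⟨ae_subset_uniformCover hmeas hindep hunif hc, fun hA =>
    ⟨measure_covering_eq_zero_of_analyticSet hmeas hindep hunif hc hA, fun _ hS hSA =>
      measure_eq_zero_of_subset_covering hmeas hindep hunif hc hA hS hSA⟩⟩
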